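/- Let $\mathfrak V$ be the complex Virasoro algebra, with basis $\{\mathtt c\}\cup\{\mathtt l_i : i\in\mathbb Z\}$ and bracket $[\mathtt l_i,\mathtt l_j]=(j-i)\mathtt l_{i+j}+\delta_{i,-j}\frac{i^3-i}{12}\mathtt c$, $[\mathtt l_i,\mathtt c]=0$, and let $\mathfrak n$ be its Lie subalgebra spanned by the $\mathtt l_i$ with $i\ge 1$. Let $z\in\mathbb C$ be nonzero, let $\mathfrak a_z\subseteq\mathfrak n$ be the Lie subalgebra spanned by the elements $\mathtt l_k-z^{k-1}\mathtt l_1$, $k\ge 2$, and, for $\mathbf m=(m_2,m_3,m_4)\in\mathbb C^3$, let $\mathbb C_{\mathbf m}$ be the one-dimensional $\mathfrak a_z$-module $\mathbb C$ on which $\mathtt l_k-z^{k-1}\mathtt l_1$ acts as the scalar $m_k$ for $k=2,3,4$ and as the scalar $-(k-4)m_3z^{k-3}+(k-3)m_4z^{k-4}$ for $k>4$. Put $V_{\mathbf m}=\mathrm{Ind}_{\mathfrak a_z}^{\mathfrak n}\mathbb C_{\mathbf m}=U(\mathfrak n)\otimes_{U(\mathfrak a_z)}\mathbb C_{\mathbf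 m}$. Then: 1. The vectors $\mathtt l_1^k\otimes 1$, $k\ge 0$, form a basis of $V_{\mathbf m}$ over $\mathbb C$. 2. The $\mathfrak n$-module $V_{\mathbf m}$ is simple if and only if $zm_3\neq m_4$. 3. If $zm_3=m_4$, then there is a one-dimensional $\mathfrak n$-module on which $\mathtt l_1$ acts as $-\frac{m_3}{z^2}$, $\mathtt l_2$ acts as $m_2-\frac{m_3}{z}$ and $\mathtt l_k$ acts as $0$ for all $k\ge 3$, and there is a surjective homomorphism of $\mathfrak n$-modules from $V_{\mathbf m}$ onto it. -/

import Mathlib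

open scoped TensorProduct

attribute [local instance 100] LieRing.ofAssociativeRing

noncomputable section

/-! ### The Virasoro algebra -/

/-- The underlying space of the complex Virasoro algebra: the complex vector space with basis
`l i` (`i : ℤ`) and `c`. -/
def Virasoro : Type := (ℤ →₀ ℂ) × ℂ

namespace Virasoro

instance : AddCommGroup Virasoro := inferInstanceAs (AddCommGroup ((ℤ →₀ ℂ) × ℂ))
instance : Module ℂ Virasoro := inferInstanceAs (Module ℂ ((ℤ →₀ ℂ) × ℂ))

/-- The basis vector `l i`. -/
def l (i : ℤ) : Virasoro := (Finsupp.single i 1, 0)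

/-- The central basis vector `c`. -/
def c : Virasoro := (0, 1)

/-- The coefficients along the `l i`. -/
def coeffs : Virasoro →ₗ[ℂ] (ℤ →₀ ℂ) := LinearMap.fst ℂ (ℤ →₀ ℂ) ℂ

/-- The bilinear map given on basis vectors by
`[l i, l j] = (j - i) l (i + j) + δ_{i,-j} (i ^ 3 - i) / 12 c`. -/
def bracketAux : (ℤ →₀ ℂ) →ₗ[ℂ] (ℤ →₀ ℂ) →ₗ[ℂ] Virasoro :=
  Finsupp.linearCombination ℂ fun i : ℤ => Finsupp.linearCombination ℂ fun j : ℤ =>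
    ((j : ℂ) - i) • l (i + j) + (if i = -j then ((i : ℂ) ^ 3 - i) / 12 else 0) • c

/-- The bracket; `c` is central. -/
instance : Bracket Virasoro Virasoro := ⟨fun x y => bracketAux (coeffs x) (coeffs y)⟩

theorem bracket_def (x y : Virasoro) : ⁅x, y⁆ = bracketAux (coeffs x) (coeffs y) := rfl

@[simp] theorem coeffs_l (i : ℤ) : coeffs (l i) = Finsupp.single i 1 := rfl

@[simp] theorem coeffs_c : coeffs c = 0 := rfl

theorem bracket_l_l (i j : ℤ) : ⁅l i, l j⁆ =
    ((j : ℂ) - i) • l (i + j) + (if i = -j then ((i : ℂ) ^ 3 - i) / 12 else 0) • c := by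
  simp [bracket_def, bracketAux]

theorem bracket_l_c (i : ℤ) : ⁅l i, c⁆ = 0 := by
  simp [bracket_def]

theorem bracketAux_swap (u v : ℤ →₀ ℂ) : bracketAux u v = -bracketAux v u := by
  have h : bracketAux = -bracketAux.flip := by
    ext i j : 4
    simp only [bracketAux, LinearMap.comp_apply, Finsupp.lsingle_apply, LinearMap.neg_apply,
      LinearMap.flip_apply, Finsupp.linearCombination_single, one_smul]
    rw [add_comm j i]
    by_cases h : i = -j
    · subst h
      rw [if_pos rfl, if_pos (by simp), neg_add, ← neg_smul, ← neg_smul]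
      push_cast
      congr 2 <;> ring
    · rw [if_neg h, if_neg (by omega), zero_smul, add_zero, add_zero, ← neg_smul, neg_sub]
  exact LinearMap.congr_fun₂ h u v

theorem jacobi_aux (u v w : ℤ →₀ ℂ) :
    bracketAux u (coeffs (bracketAux v w)) =
      bracketAux (coeffs (bracketAux u v)) w + bracketAux v (coeffs (bracketAux u w)) := by
  induction u using Finsupp.induction_linear with
  | zero => simp
  | add u u' hu hu' => simp only [map_add, LinearMap.add_apply, hu, hu']; abel
  | single i a =>
  induction v using Finsupp.induction_linear with
  | zero => simp
  | add v v' hv hv' => simp only [map_add, LinearMap.add_apply, hv, hv']; abel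
  | single j b =>
  induction w using Finsupp.induction_linear with
  | zero => simp
  | add w w' hw hw' => simp only [map_add, hw, hw']; abel
  | single k d =>
    simp only [bracketAux, Finsupp.linearCombination_single, LinearMap.smul_apply, map_smul,
      map_add, coeffs_l, coeffs_c, smul_zero, add_zero, one_smul, smul_add, smul_smul]
    rw [show i + j + k = i + (j + k) by ring, show j + (i + k) = i + (j + k) by ring]
    by_cases h : i + j + k = 0
    · obtain rfl : k = -i - j := by omega
      rw [if_pos (by ring), if_pos (by ring), if_pos (by ring)]
      push_cast
      module
    · rw [if_neg (by omega), if_neg (by omega), if_neg (by omega)]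
      push_cast
      module

instance : LieRing Virasoro where
  add_lie x y z := by simp [bracket_def]
  lie_add x y z := by simp [bracket_def]
  lie_self x := by
    have h := bracketAux_swap (coeffs x) (coeffs x)
    rw [eq_neg_iff_add_eq_zero, ← two_smul ℂ] at h
    exact (smul_eq_zero.mp h).resolve_left two_ne_zero
  leibniz_lie x y z := jacobi_aux (coeffs x) (coeffs y) (coeffs z)

instance : LieAlgebra ℂ Virasoro where
  lie_smul a x y := by simp [bracket_def]

/-! ### The positive part and its subalgebras of codimension one -/

/-- The positive part `𝔫` of the Virasoro algebra: the Lie subalgebra spanned by the `l i` with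
`i ≥ 1`. -/
def positivePart : LieSubalgebra ℂ Virasoro where
  toSubmodule := Submodule.span ℂ {x | ∃ i : ℤ, 1 ≤ i ∧ x = l i}
  lie_mem' {x y} hx hy := by
    simp only [AddSubsemigroup.mem_carrier, AddSubmonoid.mem_toSubsemigroup,
      Submodule.mem_toAddSubmonoid] at hx hy ⊢
    induction hx, hy using Submodule.span_induction₂ with
    | mem_mem x y hx hy =>
      obtain ⟨i, hi, rfl⟩ := hx
      obtain ⟨j, hj, rfl⟩ := hy
      rw [bracket_l_l, if_neg (by omega), zero_smul, add_zero]
      exact Submodule.smul_mem _ _ (Submodule.subset_span ⟨i + j, by omega, rfl⟩)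
    | zero_left y hy => simp
    | zero_right x hx => simp
    | add_left x y z _ _ _ h₁ h₂ => rw [add_lie]; exact Submodule.add_mem _ h₁ h₂
    | add_right x y z _ _ _ h₁ h₂ => rw [lie_add]; exact Submodule.add_mem _ h₁ h₂
    | smul_left r x y _ _ h => rw [smul_lie]; exact Submodule.smul_mem _ _ h
    | smul_right r x y _ _ h => rw [lie_smul]; exact Submodule.smul_mem _ _ h

/-- The element `l k` of the positive part, for `k ≥ 1`. -/
def posL (k : ℕ+) : positivePart :=
  ⟨l (k : ℕ), Submodule.subset_span ⟨_, by exact_mod_cast k.pos, rfl⟩⟩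

theorem bracket_posL (i j : ℕ+) : ⁅posL i, posL j⁆ = ((j : ℂ) - (i : ℂ)) • posL (i + j) := by
  apply Subtype.ext
  have hi := i.pos
  change ⁅l ((i : ℕ) : ℤ), l ((j : ℕ) : ℤ)⁆ = ((j : ℂ) - (i : ℂ)) • l ((i + j : ℕ+) : ℕ)
  rw [bracket_l_l, if_neg (by omega)]
  simp

/-- The element `l k - z ^ (k - 1) l 1` of the positive part, for `k ≥ 1`. -/
def lHat (z : ℂ) (k : ℕ+) : positivePart := posL k - z ^ ((k : ℕ) - 1) • posL 1

theorem bracket_lHat (z : ℂ) (i j : ℕ+) : ⁅lHat z i, lHat z j⁆ =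
    ((j : ℂ) - i) • lHat z (i + j) - (((j : ℂ) - 1) * z ^ ((i : ℕ) - 1)) • lHat z (j + 1)
      + (((i : ℂ) - 1) * z ^ ((j : ℕ) - 1)) • lHat z (i + 1) := by
  obtain ⟨a, ha⟩ : ∃ a, (i : ℕ) = a + 1 := ⟨i - 1, by have := i.pos; omega⟩
  obtain ⟨b, hb⟩ : ∃ b, (j : ℕ) = b + 1 := ⟨j - 1, by have := j.pos; omega⟩
  simp only [lHat, sub_lie, lie_sub, smul_lie, lie_smul, bracket_posL, PNat.add_coe, PNat.one_coe,
    add_comm 1 j, add_comm i 1, ha, hb, show a + 1 + (b + 1) - 1 = a + b + 1 by omega,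
    Nat.add_sub_cancel, lie_self]
  rw [show 1 + (a + 1) - 1 = a + 1 by omega]
  push_cast
  module

/-- The codimension one subalgebra `𝔞_z` of the positive part: the linear span of the elements
`l k - z ^ (k - 1) l 1` with `k ≥ 2`. -/
def codimOne (z : ℂ) : LieSubalgebra ℂ positivePart where
  toSubmodule := Submodule.span ℂ {x | ∃ k : ℕ+, 2 ≤ k ∧ x = lHat z k}
  lie_mem' {x y} hx hy := by
    simp only [AddSubsemigroup.mem_carrier, AddSubmonoid.mem_toSubsemigroup,
      Submodule.mem_toAddSubmonoid] at hx hy ⊢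
    induction hx, hy using Submodule.span_induction₂ with
    | mem_mem x y hx hy =>
      obtain ⟨i, hi, rfl⟩ := hx
      obtain ⟨j, hj, rfl⟩ := hy
      rw [bracket_lHat]
      refine Submodule.add_mem _ (Submodule.sub_mem _ ?_ ?_) ?_ <;>
        refine Submodule.smul_mem _ _ (Submodule.subset_span ⟨_, ?_, rfl⟩)
      · exact hi.trans (PNat.lt_add_right i j).le
      · exact hj.trans (PNat.lt_add_right j 1).le
      · exact hi.trans (PNat.lt_add_right i 1).le
    | zero_left y hy => simp
    | zero_right x hx => simp
    | add_left x y z _ _ _ h₁ h₂ => rw [add_lie]; exact Submodule.add_mem _ h₁ h₂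
    | add_right x y z _ _ _ h₁ h₂ => rw [lie_add]; exact Submodule.add_mem _ h₁ h₂
    | smul_left r x y _ _ h => rw [smul_lie]; exact Submodule.smul_mem _ _ h
    | smul_right r x y _ _ h => rw [lie_smul]; exact Submodule.smul_mem _ _ h

/-- The element `l k - z ^ (k - 1) l 1` of `𝔞_z`, for `k ≥ 2`. -/
def codimOneGen (z : ℂ) (k : ℕ+) (hk : 2 ≤ k) : codimOne z :=
  ⟨lHat z k, Submodule.subset_span ⟨k, hk, rfl⟩⟩

/-! ### The one-dimensional `𝔞_z`-modules -/

/-- The scalar by which `l k - z ^ (k - 1) l 1` acts: `m₂`, `m₃`, `m₄` for `k = 2, 3, 4` and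
`-(k - 4) m₃ z ^ (k - 3) + (k - 3) m₄ z ^ (k - 4)` for `k > 4`
(and `0` for `k ≤ 1`, which plays no role). -/
def scalar (z m₂ m₃ m₄ : ℂ) (k : ℕ) : ℂ :=
  if k ≤ 1 then 0
  else if k = 2 then m₂
  else if k = 3 then m₃
  else if k = 4 then m₄
  else -((k : ℂ) - 4) * m₃ * z ^ (k - 3) + ((k : ℂ) - 3) * m₄ * z ^ (k - 4)

theorem scalar_add_three (z m₂ m₃ m₄ : ℂ) (k : ℕ) : scalar z m₂ m₃ m₄ (k + 3) =
    -((k : ℂ) - 1) * m₃ * z ^ k + (k : ℂ) * m₄ * z ^ (k - 1) := by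
  match k with
  | 0 => simp [scalar]
  | 1 => simp [scalar]
  | k + 2 =>
    simp only [scalar, if_neg (show ¬ k + 2 + 3 ≤ 1 by omega), if_neg (show k + 2 + 3 ≠ 2 by omega),
      if_neg (show k + 2 + 3 ≠ 3 by omega), if_neg (show k + 2 + 3 ≠ 4 by omega)]
    rw [show k + 2 + 3 - 3 = k + 2 by omega, show k + 2 + 3 - 4 = k + 2 - 1 by omega]
    push_cast
    ring

/-- The linear functional on the positive part sending `l 1` to `0` and `l k` to the given scalar
for `k ≥ 2`. -/
def functional (z m₂ m₃ m₄ : ℂ) : positivePart →ₗ[ℂ] ℂ :=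
  Finsupp.linearCombination ℂ (fun i : ℤ => scalar z m₂ m₃ m₄ i.toNat) ∘ₗ coeffs ∘ₗ
    positivePart.toSubmodule.subtype

theorem functional_posL (z m₂ m₃ m₄ : ℂ) (k : ℕ+) :
    functional z m₂ m₃ m₄ (posL k) = scalar z m₂ m₃ m₄ k := by
  change Finsupp.linearCombination ℂ (fun i : ℤ => scalar z m₂ m₃ m₄ i.toNat)
    (Finsupp.single ((k : ℕ) : ℤ) 1) = _
  simp

theorem functional_lHat (z m₂ m₃ m₄ : ℂ) (k : ℕ+) :
    functional z m₂ m₃ m₄ (lHat z k) = scalar z m₂ m₃ m₄ k := by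
  rw [lHat, map_sub, map_smul, functional_posL, functional_posL]
  simp [scalar]

/-- The character of `𝔞_z` sending `l k - z ^ (k - 1) l 1` to the scalar above, for `k ≥ 2`: the
restriction of the functional above. -/
def character (z m₂ m₃ m₄ : ℂ) : LieAlgebra.LieCharacter ℂ (codimOne z) where
  toFun x := functional z m₂ m₃ m₄ (x : positivePart)
  map_add' x y := by simp
  map_smul' a x := by simp
  map_lie' {x y} := by
    suffices h : functional z m₂ m₃ m₄ (⁅(x : positivePart), (y : positivePart)⁆ : positivePart)
        = 0 by
      rw [LieRing.of_associative_ring_bracket, mul_comm, sub_self]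
      exact h
    obtain ⟨x, hx⟩ := x
    obtain ⟨y, hy⟩ := y
    change x ∈ Submodule.span ℂ _ at hx
    change y ∈ Submodule.span ℂ _ at hy
    induction hx, hy using Submodule.span_induction₂ with
    | mem_mem x y hx hy =>
      obtain ⟨i, hi, rfl⟩ := hx
      obtain ⟨j, hj, rfl⟩ := hy
      obtain ⟨a, ha⟩ := Nat.exists_eq_add_of_le (show 2 ≤ (i : ℕ) from hi)
      obtain ⟨b, hb⟩ := Nat.exists_eq_add_of_le (show 2 ≤ (j : ℕ) from hj)
      rw [bracket_lHat]
      simp only [map_add, map_sub, map_smul, functional_lHat, PNat.add_coe, PNat.one_coe, smul_eq_mul, ha, hb]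
      rw [show 2 + a + (2 + b) = (a + b + 1) + 3 by ring, show 2 + b + 1 = b + 3 by ring,
        show 2 + a + 1 = a + 3 by ring, show 2 + a - 1 = a + 1 by omega,
        show 2 + b - 1 = b + 1 by omega]
      simp only [scalar_add_three]
      rcases a with _ | a <;> rcases b with _ | b <;>
        simp only [Nat.add_sub_cancel, Nat.zero_add, Nat.add_zero] <;> push_cast <;> ring_nf
    | zero_left y hy => simp
    | zero_right x hx => simp
    | add_left x y z _ _ _ h₁ h₂ => simp_all
    | add_right x y z _ _ _ h₁ h₂ => simp_all
    | smul_left r x y _ _ h => simp_all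
    | smul_right r x y _ _ h => simp_all

theorem character_apply (z m₂ m₃ m₄ : ℂ) (k : ℕ+) (hk : 2 ≤ k) :
    character z m₂ m₃ m₄ (codimOneGen z k hk) = scalar z m₂ m₃ m₄ k :=
  functional_lHat z m₂ m₃ m₄ k

end Virasoro

/-! ### One-dimensional modules and induced modules -/

/-- The one-dimensional module on which a Lie algebra acts by the character `χ`. -/
def CharModule {R L : Type*} [CommRing R] [LieRing L] [LieAlgebra R L]
    (_χ : LieAlgebra.LieCharacter R L) : Type _ := R

namespace CharModule

variable {R L : Type*} [CommRing R] [LieRing L] [LieAlgebra R L] (χ : LieAlgebra.LieCharacter R L)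

instance : AddCommGroup (CharModule χ) := inferInstanceAs (AddCommGroup R)
instance : Module R (CharModule χ) := inferInstanceAs (Module R R)

instance : LieRingModule L (CharModule χ) where
  bracket x v := χ x • v
  add_lie x y v := by rw [map_add, add_smul]
  lie_add x v w := smul_add _ _ _
  leibniz_lie x y v := by
    change χ x • χ y • v = χ ⁅x, y⁆ • v + χ y • χ x • v
    rw [LieAlgebra.lieCharacter_apply_lie, zero_smul, zero_add, smul_comm]

instance : LieModule R L (CharModule χ) where
  smul_lie a x v := by
    change χ (a • x) • v = a • χ x • v
    rw [map_smul, smul_assoc]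
  lie_smul a x v := smul_comm (χ x) a v

theorem lie_def (x : L) (v : CharModule χ) : ⁅x, v⁆ = χ x • v := rfl

/-- The standard basis vector. -/
def gen : CharModule χ := (1 : R)

end CharModule

namespace LieInduction

variable {R L : Type*} [CommRing R] [LieRing L] [LieAlgebra R L] (H : LieSubalgebra R L)
  (M : Type*) [AddCommGroup M] [Module R M] [LieRingModule H M] [LieModule R H M]

/-- The algebra homomorphism `U(H) → U(L)` induced by the inclusion of a Lie subalgebra `H`. -/
def envelopingMap : UniversalEnvelopingAlgebra R H →ₐ[R] UniversalEnvelopingAlgebra R L :=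
  UniversalEnvelopingAlgebra.lift R ((UniversalEnvelopingAlgebra.ι R).comp H.incl)

/-- The action of `U(H)` on an `H`-module. -/
def envelopingAction : UniversalEnvelopingAlgebra R H →ₐ[R] Module.End R M :=
  UniversalEnvelopingAlgebra.lift R (LieModule.toEnd R H M)

/-- The relations `u a ⊗ m = u ⊗ a m` for `a ∈ U(H)`. -/
def relations :
    Submodule (UniversalEnvelopingAlgebra R L) (UniversalEnvelopingAlgebra R L ⊗[R] M) :=
  Submodule.span _ {t | ∃ (u : UniversalEnvelopingAlgebra R L) (a : UniversalEnvelopingAlgebra R H)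
    (m : M), t = (u * envelopingMap H a) ⊗ₜ[R] m - u ⊗ₜ[R] (envelopingAction H M a m)}

/-- The induced module `Ind_H^L M = U(L) ⊗_{U(H)} M`. The tensor product over `U(H)` is the
quotient of the tensor product over `R` by the relations `u a ⊗ m = u ⊗ a m` (these form a
`U(L)`-stable set). -/
def Ind : Type _ := (UniversalEnvelopingAlgebra R L ⊗[R] M) ⧸ relations H M

instance : AddCommGroup (Ind H M) :=
  inferInstanceAs (AddCommGroup ((UniversalEnvelopingAlgebra R L ⊗[R] M) ⧸ relations H M))

instance : Module (UniversalEnvelopingAlgebra R L) (Ind H M) :=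
  inferInstanceAs (Module _ ((UniversalEnvelopingAlgebra R L ⊗[R] M) ⧸ relations H M))

instance : Module R (Ind H M) :=
  inferInstanceAs (Module R ((UniversalEnvelopingAlgebra R L ⊗[R] M) ⧸ relations H M))

instance : IsScalarTower R (UniversalEnvelopingAlgebra R L) (Ind H M) :=
  inferInstanceAs (IsScalarTower R _ ((UniversalEnvelopingAlgebra R L ⊗[R] M) ⧸ relations H M))

/-- The element `u ⊗ m` of the induced module. -/
def tmul (u : UniversalEnvelopingAlgebra R L) (m : M) : Ind H M :=
  Submodule.Quotient.mk (p := relations H M) (u ⊗ₜ[R] m)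

/-- `L` acts on the induced module through `L → U(L)`. -/
instance : LieRingModule L (Ind H M) where
  bracket x v := UniversalEnvelopingAlgebra.ι R x • v
  add_lie x y v := by rw [map_add, add_smul]
  lie_add x v w := smul_add _ _ _
  leibniz_lie x y v := by
    change UniversalEnvelopingAlgebra.ι R x • UniversalEnvelopingAlgebra.ι R y • v =
      UniversalEnvelopingAlgebra.ι R ⁅x, y⁆ • v +
        UniversalEnvelopingAlgebra.ι R y • UniversalEnvelopingAlgebra.ι R x • v
    rw [LieHom.map_lie, LieRing.of_associative_ring_bracket, sub_smul, mul_smul, mul_smul,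
      sub_add_cancel]

instance : LieModule R L (Ind H M) where
  smul_lie a x v := by
    change UniversalEnvelopingAlgebra.ι R (a • x) • v = a • UniversalEnvelopingAlgebra.ι R x • v
    rw [map_smul, smul_assoc]
  lie_smul a x v := by
    change UniversalEnvelopingAlgebra.ι R x • a • v = a • UniversalEnvelopingAlgebra.ι R x • v
    rw [← algebraMap_smul (UniversalEnvelopingAlgebra R L) a v,
      ← algebraMap_smul (UniversalEnvelopingAlgebra R L) a (_ • v), ← mul_smul, ← mul_smul,
      Algebra.commutes]

end LieInduction

namespace Virasoro

/-- The one-dimensional `𝔞_z`-module `ℂ_𝐦`, `𝐦 = (m₂, m₃, m₄)`. -/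
abbrev OneDim (z m₂ m₃ m₄ : ℂ) : Type := CharModule (character z m₂ m₃ m₄)

/-- The induced `𝔫`-module `V_𝐦`. -/
abbrev V (z m₂ m₃ m₄ : ℂ) : Type := LieInduction.Ind (codimOne z) (OneDim z m₂ m₃ m₄)

/-- The vector `l 1 ^ k ⊗ 1` of `V_𝐦`. -/
def powGen (z m₂ m₃ m₄ : ℂ) (k : ℕ) : V z m₂ m₃ m₄ :=
  LieInduction.tmul (codimOne z) (OneDim z m₂ m₃ m₄)
    (UniversalEnvelopingAlgebra.ι ℂ (posL 1) ^ k) (CharModule.gen (character z m₂ m₃ m₄))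

end Virasoro

end

/-! The induced module is realised on ℂ[s]. Put X = z - d/ds and let S be multiplication by s; then
S X - X S = 1, so S acts as a derivation d/dX. For every b the assignment f ↦ S f(X) + b f'(X) turns
f g' - f' g into a commutator, so l_k ↦ S X^(k+1) + b (k+1) X^k + t_k represents 𝔫 whenever t_k = 0
for k ≥ 3 (`polyRep`). Since X^n 1 = z^n, l_k sends 1 to z^(k+1) s plus a constant; the s-terms
cancel in l_k - z^(k-1) l_1, and 1 is an eigenvector of 𝔞_z. Matching eigenvalues forces t_1, t_2
and b = (m₄ - z m₃) / z⁴. Frobenius reciprocity (`indLift`) then gives `toPoly`, with 1 ⊗ 1 ↦ 1.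

As z ≠ 0, l_1 raises degrees by exactly one, so the images of the l_1^k ⊗ 1 are independent. These
vectors also span (`span_powGen`), hence they form a basis and `toPoly` is injective.

If b ≠ 0, the nilpotency of X - z = -d/ds on each polynomial lets one element of 𝔫 move any nonzero
vector to a nonzero multiple of the generator (`exists_polyRep_eq_C`). If b = 0, the character t
itself restricts to the given one on 𝔞_z, so the infinite-dimensional V_m has a one-dimensional
quotient. -/

/-- Induction on elements of the enveloping algebra. -/
theorem UniversalEnvelopingAlgebra.induction_on {R L : Type*} [CommRing R] [LieRing L]
    [LieAlgebra R L] {P : UniversalEnvelopingAlgebra R L → Prop}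
    (algebraMap : ∀ r, P (algebraMap R _ r)) (ι : ∀ x, P (UniversalEnvelopingAlgebra.ι R x))
    (mul : ∀ a b, P a → P b → P (a * b)) (add : ∀ a b, P a → P b → P (a + b))
    (u : UniversalEnvelopingAlgebra R L) : P u := by
  let S : Subalgebra R (UniversalEnvelopingAlgebra R L) :=
    { carrier := {u | P u}
      mul_mem' := fun {a b} => mul a b
      add_mem' := fun {a b} => add a b
      algebraMap_mem' := algebraMap }
  let f : L →ₗ⁅R⁆ S :=
    { toFun := fun x => ⟨UniversalEnvelopingAlgebra.ι R x, ι x⟩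
      map_add' := fun x y => Subtype.ext (map_add _ x y)
      map_smul' := fun r x => Subtype.ext (map_smul _ r x)
      map_lie' := fun {x y} => Subtype.ext (LieHom.map_lie _ x y) }
  have h : S.val.comp (UniversalEnvelopingAlgebra.lift R f) = AlgHom.id R _ := by
    ext x
    simp [f]
  have hu := (UniversalEnvelopingAlgebra.lift R f u).2
  have e : ((UniversalEnvelopingAlgebra.lift R f u : S) : UniversalEnvelopingAlgebra R L) = u :=
    DFunLike.congr_fun h u
  rw [e] at hu
  exact hu

/-! ### Modules induced from a character, and Frobenius reciprocity for them. -/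

namespace LieInduction

section

variable {R L : Type*} [CommRing R] [LieRing L] [LieAlgebra R L] {H : LieSubalgebra R L}
  (χ : LieAlgebra.LieCharacter R H) {N : Type*} [AddCommGroup N] [Module R N]
  (ρ : L →ₗ⁅R⁆ Module.End R N) (v : N)

/-- The coordinate with respect to the standard basis vector. -/
def coord : CharModule χ →ₗ[R] R := LinearMap.id

theorem lie_eq_ι_smul (x : L) (w : Ind H (CharModule χ)) :
    ⁅x, w⁆ = UniversalEnvelopingAlgebra.ι R x • w := rfl

theorem smul_tmul (u u' : UniversalEnvelopingAlgebra R L) (m : CharModule χ) :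
    u • tmul H (CharModule χ) u' m = tmul H (CharModule χ) (u * u') m := rfl

/-- The generator `1 ⊗ 1` of a module induced from a character. -/
noncomputable def indGen : Ind H (CharModule χ) := tmul H (CharModule χ) 1 (CharModule.gen χ)

theorem tmul_gen (u : UniversalEnvelopingAlgebra R L) :
    tmul H (CharModule χ) u (CharModule.gen χ) = u • indGen χ := by
  rw [indGen, smul_tmul, mul_one]

/-- The generator is an eigenvector of the subalgebra. -/
theorem lie_indGen (h : H) : ⁅(h : L), indGen χ⁆ = χ h • indGen χ := by
  have key : tmul H (CharModule χ) (1 * envelopingMap H (UniversalEnvelopingAlgebra.ι R h))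
      (CharModule.gen χ) = tmul H (CharModule χ) 1
        (envelopingAction H (CharModule χ) (UniversalEnvelopingAlgebra.ι R h)
          (CharModule.gen χ)) :=
    (Submodule.Quotient.eq _).2 (Submodule.subset_span ⟨_, _, _, rfl⟩)
  have e1 : envelopingMap H (UniversalEnvelopingAlgebra.ι R h) =
      UniversalEnvelopingAlgebra.ι R (h : L) := by
    simp [envelopingMap]
  have e2 : envelopingAction H (CharModule χ) (UniversalEnvelopingAlgebra.ι R h)
      (CharModule.gen χ) = χ h • CharModule.gen χ := by
    simp [envelopingAction, CharModule.lie_def]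
  rw [e1, e2, one_mul, tmul_gen] at key
  rw [lie_eq_ι_smul, key]
  unfold indGen tmul
  rw [TensorProduct.tmul_smul]
  rfl

/-- The induced module is generated by `1 ⊗ 1` over the enveloping algebra. -/
theorem span_indGen :
    Submodule.span (UniversalEnvelopingAlgebra R L) {indGen χ} = ⊤ := by
  refine eq_top_iff.2 fun w _ => ?_
  obtain ⟨t, rfl⟩ := Submodule.Quotient.mk_surjective _ w
  induction t using TensorProduct.induction_on with
  | zero => exact Submodule.zero_mem _
  | add s t hs ht => exact Submodule.add_mem _ (hs trivial) (ht trivial)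
  | tmul u m =>
    refine Submodule.mem_span_singleton.2
      ⟨coord χ m • u, ?_⟩
    rw [indGen, smul_tmul, mul_one]
    refine congrArg (Submodule.Quotient.mk (p := relations H (CharModule χ))) ?_
    rw [TensorProduct.smul_tmul]
    congr 1
    exact mul_one (coord χ m)

/-- A subspace containing `1 ⊗ 1` and stable under the Lie algebra is everything. -/
theorem eq_top_of_indGen_mem (S : Submodule R (Ind H (CharModule χ)))
    (hgen : indGen χ ∈ S) (hS : ∀ (x : L), ∀ w ∈ S, ⁅x, w⁆ ∈ S) : S = ⊤ := by
  have hU : ∀ (u : UniversalEnvelopingAlgebra R L), ∀ w ∈ S, u • w ∈ S := by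
    intro u
    induction u using UniversalEnvelopingAlgebra.induction_on with
    | algebraMap r => intro w hw; rw [algebraMap_smul]; exact S.smul_mem r hw
    | ι x => exact hS x
    | mul a b ha hb => intro w hw; rw [mul_smul]; exact ha _ (hb _ hw)
    | add a b ha hb => intro w hw; rw [add_smul]; exact S.add_mem (ha _ hw) (hb _ hw)
  refine eq_top_iff.2 fun w _ => ?_
  have hw : w ∈ Submodule.span (UniversalEnvelopingAlgebra R L) {indGen χ} := by
    rw [span_indGen]; trivial
  obtain ⟨u, rfl⟩ := Submodule.mem_span_singleton.1 hw
  exact hU u _ hgen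

/-- The map `u ⊗ a ↦ a ρ(u) v` before passing to the quotient. -/
noncomputable def tensorLift : UniversalEnvelopingAlgebra R L ⊗[R] CharModule χ →ₗ[R] N :=
  TensorProduct.lift
    (((LinearMap.lsmul R N).flip.comp ((LinearMap.applyₗ v).comp
      (UniversalEnvelopingAlgebra.lift R ρ).toLinearMap)).compl₂ (coord χ))

theorem tensorLift_tmul (u : UniversalEnvelopingAlgebra R L) (m : CharModule χ) :
    tensorLift χ ρ v (u ⊗ₜ m) = coord χ m • UniversalEnvelopingAlgebra.lift R ρ u v := by
  simp [tensorLift]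

theorem tensorLift_smul (u : UniversalEnvelopingAlgebra R L)
    (t : UniversalEnvelopingAlgebra R L ⊗[R] CharModule χ) :
    tensorLift χ ρ v (u • t) = UniversalEnvelopingAlgebra.lift R ρ u (tensorLift χ ρ v t) := by
  induction t using TensorProduct.induction_on with
  | zero => simp
  | add s t hs ht => rw [smul_add, map_add, hs, ht, map_add, map_add]
  | tmul u' m =>
    rw [TensorProduct.smul_tmul', tensorLift_tmul, tensorLift_tmul, smul_eq_mul, map_mul, map_smul]
    rfl

/-- U(H) preserves the line through `v`, so checking generators is enough. This is what makes
`tensorLift` kill the defining relations. -/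
theorem lift_envelopingMap_apply (hv : ∀ h : H, ρ h v = χ h • v)
    (a : UniversalEnvelopingAlgebra R H) (m : CharModule χ) :
    coord χ m • UniversalEnvelopingAlgebra.lift R ρ (envelopingMap H a) v =
      coord χ (envelopingAction H (CharModule χ) a m) • v := by
  induction a using UniversalEnvelopingAlgebra.induction_on generalizing m with
  | algebraMap r =>
    rw [AlgHom.commutes, AlgHom.commutes, AlgHom.commutes, Module.algebraMap_end_apply,
      Module.algebraMap_end_apply, map_smul, smul_smul, mul_comm, smul_eq_mul]
  | ι x =>
    simp only [envelopingMap, envelopingAction, UniversalEnvelopingAlgebra.lift_ι_apply,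
      LieHom.comp_apply, LieSubalgebra.coe_incl, hv, LieModule.toEnd_apply_apply,
      CharModule.lie_def, map_smul]
    rw [smul_smul, mul_comm, smul_eq_mul]
  | mul a b ha hb =>
    simp only [map_mul, Module.End.mul_apply]
    -- `ha` is applied at the vector `b m`, which is why the induction generalizes `m`.
    rw [← map_smul, hb, map_smul, ha]
  | add a b ha hb =>
    simp only [map_add, LinearMap.add_apply, smul_add, ha, hb, add_smul]

/-- The linear map `u ⊗ 1 ↦ ρ(u) v` out of a module induced from a character, for an eigenvector
`v` of the subalgebra. -/
noncomputable def indLift (hv : ∀ h : H, ρ h v = χ h • v) : Ind H (CharModule χ) →ₗ[R] N :=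
  (((relations H (CharModule χ)).restrictScalars R).liftQ (tensorLift χ ρ v) (by
    intro t ht
    change t ∈ Submodule.span _ _ at ht
    rw [LinearMap.mem_ker]
    induction ht using Submodule.span_induction with
    | zero => simp
    | add s t _ _ hs ht => rw [map_add, hs, ht, add_zero]
    | smul u t _ ht => rw [tensorLift_smul, ht, map_zero]
    | mem t ht =>
      obtain ⟨u, a, m, rfl⟩ := ht
      rw [map_sub, tensorLift_tmul, tensorLift_tmul, map_mul, Module.End.mul_apply, ← map_smul,
        lift_envelopingMap_apply χ ρ v hv, map_smul, sub_self])).comp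
    (Submodule.Quotient.restrictScalarsEquiv R (relations H (CharModule χ))).symm.toLinearMap

theorem indLift_indGen (hv : ∀ h : H, ρ h v = χ h • v) : indLift χ ρ v hv (indGen χ) = v := by
  refine (tensorLift_tmul χ ρ v 1 (CharModule.gen χ)).trans ?_
  rw [map_one]
  exact one_smul R v

theorem indLift_lie (hv : ∀ h : H, ρ h v = χ h • v) (x : L) (w : Ind H (CharModule χ)) :
    indLift χ ρ v hv ⁅x, w⁆ = ρ x (indLift χ ρ v hv w) := by
  obtain ⟨t, rfl⟩ := Submodule.Quotient.mk_surjective _ w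
  refine (tensorLift_smul χ ρ v (UniversalEnvelopingAlgebra.ι R x) t).trans ?_
  rw [UniversalEnvelopingAlgebra.lift_ι_apply]
  rfl

end

end LieInduction

/-! ### Weyl pairs and twisted vector fields. -/

namespace Virasoro

section

open Polynomial

/-- In a Weyl pair, commuting past the derivation differentiates. -/
theorem aeval_mul_of_weyl {A : Type*} [Ring A] [Algebra ℂ A] {X S : A} (h : S * X = X * S + 1)
    (f : ℂ[X]) : aeval X f * S = S * aeval X f - aeval X (derivative f) := by
  induction f using Polynomial.induction_on with
  | C a => simp [Algebra.commutes]
  | add p q hp hq => simp only [map_add, add_mul, mul_add, hp, hq]; abel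
  | monomial n a ih =>
    have e : (C a * Polynomial.X ^ (n + 1) : ℂ[X]) = Polynomial.X * (C a * Polynomial.X ^ n) := by
      ring
    generalize (C a * Polynomial.X ^ n : ℂ[X]) = q at *
    rw [e, derivative_mul, derivative_X, one_mul, map_mul, map_add, map_mul, aeval_X, mul_assoc,
      ih, mul_sub, ← mul_assoc, ← mul_assoc, h, add_mul, one_mul]
    abel

/-- The twisted vector field `f ∂ + b f'` attached to a Weyl pair (with `∂` on the left). -/
noncomputable def vectorField {A : Type*} [Ring A] [Algebra ℂ A] (X S : A) (b : ℂ) :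
    ℂ[X] →ₗ[ℂ] A :=
  (LinearMap.mulLeft ℂ S).comp (aeval X).toLinearMap +
    b • (aeval X).toLinearMap.comp (derivative : ℂ[X] →ₗ[ℂ] ℂ[X])

theorem vectorField_apply {A : Type*} [Ring A] [Algebra ℂ A] (X S : A) (b : ℂ) (f : ℂ[X]) :
    vectorField X S b f = S * aeval X f + b • aeval X (derivative f) := rfl

/-- Once every S is moved to the left, the S² and b² terms and those of the form b S (f g)' are
symmetric in f and g and cancel. What remains is S (f g' - f' g) + b (f g'' - f'' g), and the last
bracket is the derivative of the first. -/
theorem bracket_vectorField {A : Type*} [Ring A] [Algebra ℂ A] {X S : A}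
    (h : S * X = X * S + 1) (b : ℂ) (f g : ℂ[X]) :
    ⁅vectorField X S b f, vectorField X S b g⁆ =
      vectorField X S b (f * derivative g - derivative f * g) := by
  have key : ∀ f g : ℂ[X], vectorField X S b f * vectorField X S b g =
      S * S * aeval X (f * g) - S * aeval X (derivative f * g)
      + b • (S * aeval X (f * derivative g)) + b • (S * aeval X (derivative f * g))
      - b • aeval X (derivative (derivative f) * g)
      + (b * b) • aeval X (derivative f * derivative g) := by
    intro f g
    simp only [vectorField_apply, add_mul, mul_add, smul_mul_assoc, mul_smul_comm]
    rw [show S * aeval X f * (S * aeval X g) = S * (aeval X f * S) * aeval X g by noncomm_ring,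
      ← mul_assoc (aeval X (derivative f)), aeval_mul_of_weyl h, aeval_mul_of_weyl h]
    simp only [map_mul, mul_sub, sub_mul, smul_sub, smul_add, smul_smul, mul_assoc]
    abel
  rw [LieRing.of_associative_ring_bracket, key, key, vectorField_apply, mul_comm g f,
    mul_comm (derivative g) f, mul_comm g (derivative f), mul_comm (derivative g) (derivative f),
    mul_comm (derivative (derivative g)) f, derivative_sub, derivative_mul, derivative_mul]
  simp only [map_sub, map_add, mul_sub, smul_sub, smul_add]
  abel

/-- Multiplication by the variable on `ℂ[s]`. -/
noncomputable def mulVar : Module.End ℂ ℂ[X] := LinearMap.mulLeft ℂ Polynomial.X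

/-- The operator `z - d/ds` on `ℂ[s]`. -/
noncomputable def shiftOp (z : ℂ) : Module.End ℂ ℂ[X] :=
  algebraMap ℂ _ z - (derivative : ℂ[X] →ₗ[ℂ] ℂ[X])

theorem mulVar_mul_shiftOp (z : ℂ) : mulVar * shiftOp z = shiftOp z * mulVar + 1 := by
  refine LinearMap.ext fun q => ?_
  simp [mulVar, shiftOp, Module.algebraMap_end_apply, derivative_mul, smul_eq_C_mul]
  ring

end

/-! ### Homomorphisms out of the positive part. -/

section

variable {A : Type*} [LieRing A] [LieAlgebra ℂ A]

theorem span_posL : Submodule.span ℂ (Set.range posL) = ⊤ := by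
  refine eq_top_iff.2 fun x _ => ?_
  obtain ⟨x, hx⟩ := x
  change x ∈ Submodule.span ℂ _ at hx
  induction hx using Submodule.span_induction with
  | mem x hx =>
    obtain ⟨i, hi, rfl⟩ := hx
    refine Submodule.subset_span ⟨⟨i.toNat, by omega⟩, Subtype.ext ?_⟩
    exact congrArg l (Int.toNat_of_nonneg (by omega))
  | zero => exact Submodule.zero_mem _
  | add x y _ _ hx hy => exact Submodule.add_mem _ (hx trivial) (hy trivial)
  | smul a x _ hx => exact Submodule.smul_mem _ a (hx trivial)

/-- The linear map on the positive part with prescribed values on the `l k`. -/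
noncomputable def posLinear {A : Type*} [AddCommGroup A] [Module ℂ A] (φ : ℕ → A) :
    positivePart →ₗ[ℂ] A :=
  Finsupp.linearCombination ℂ (fun i : ℤ => φ i.toNat) ∘ₗ coeffs ∘ₗ
    positivePart.toSubmodule.subtype

theorem posLinear_posL {A : Type*} [AddCommGroup A] [Module ℂ A] (φ : ℕ → A) (k : ℕ+) :
    posLinear φ (posL k) = φ k := by
  change Finsupp.linearCombination ℂ (fun i : ℤ => φ i.toNat)
    (Finsupp.single ((k : ℕ) : ℤ) 1) = _
  simp

/-- The Lie algebra homomorphism on the positive part with prescribed values on the `l k`. -/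
noncomputable def posHom (φ : ℕ → A)
    (h : ∀ i j : ℕ+, ⁅φ i, φ j⁆ = ((j : ℂ) - (i : ℂ)) • φ (i + j : ℕ)) :
    positivePart →ₗ⁅ℂ⁆ A where
  __ := posLinear φ
  map_lie' {x y} := by
    change posLinear φ ⁅x, y⁆ = ⁅posLinear φ x, posLinear φ y⁆
    have hx : x ∈ Submodule.span ℂ (Set.range posL) := by rw [span_posL]; trivial
    have hy : y ∈ Submodule.span ℂ (Set.range posL) := by rw [span_posL]; trivial
    induction hx, hy using Submodule.span_induction₂ with
    | mem_mem x y hx hy =>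
      obtain ⟨i, rfl⟩ := hx
      obtain ⟨j, rfl⟩ := hy
      rw [bracket_posL, map_smul, posLinear_posL, posLinear_posL, posLinear_posL, h]
      rfl
    | zero_left y hy => simp
    | zero_right x hx => simp
    | add_left x y z _ _ _ h₁ h₂ => simp only [add_lie, map_add, h₁, h₂]
    | add_right x y z _ _ _ h₁ h₂ => simp only [lie_add, map_add, h₁, h₂]
    | smul_left r x y _ _ h => simp only [smul_lie, map_smul, h]
    | smul_right r x y _ _ h => simp only [lie_smul, map_smul, h]

theorem posHom_posL (φ : ℕ → A)
    (h : ∀ i j : ℕ+, ⁅φ i, φ j⁆ = ((j : ℂ) - (i : ℂ)) • φ (i + j : ℕ)) (k : ℕ+) :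
    posHom φ h (posL k) = φ k :=
  posLinear_posL φ k

/-- The subalgebra of codimension one acts on `v` by the character as soon as its generators
do. -/
theorem apply_eq_character_smul {N : Type*} [AddCommGroup N] [Module ℂ N] {z m₂ m₃ m₄ : ℂ}
    (ρ : positivePart →ₗ⁅ℂ⁆ Module.End ℂ N) (v : N)
    (hv : ∀ k : ℕ, ρ (posL k.succPNat) v - z ^ k • ρ (posL 1) v =
      scalar z m₂ m₃ m₄ (k + 1) • v) (h : codimOne z) :
    ρ h v = character z m₂ m₃ m₄ h • v := by
  obtain ⟨x, hx⟩ := h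
  change ρ x v = functional z m₂ m₃ m₄ x • v
  change x ∈ Submodule.span ℂ _ at hx
  induction hx using Submodule.span_induction with
  | mem x hx =>
    obtain ⟨k, hk, rfl⟩ := hx
    obtain ⟨n, rfl⟩ : ∃ n : ℕ, k = n.succPNat := ⟨k.natPred, (PNat.succPNat_natPred k).symm⟩
    rw [functional_lHat, Nat.succPNat_coe, ← hv n]
    simp [lHat]
  | zero => simp
  | add x y _ _ hx hy => simp only [map_add, LinearMap.add_apply, hx, hy, add_smul]
  | smul a x _ hx => simp only [map_smul, LinearMap.smul_apply, hx, smul_assoc]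

end

end Virasoro

/-! ### The realisation on polynomials. -/

namespace Virasoro

section

open Polynomial

theorem shiftOp_apply (z : ℂ) (p : ℂ[X]) : shiftOp z p = C z * p - derivative p := by
  simp [shiftOp, Module.algebraMap_end_apply, smul_eq_C_mul]

theorem mulVar_apply (p : ℂ[X]) : mulVar p = X * p := rfl

theorem shiftOp_pow_C (z a : ℂ) (n : ℕ) : (shiftOp z ^ n) (C a) = C (z ^ n * a) := by
  induction n with
  | zero => simp
  | succ n ih => rw [pow_succ', Module.End.mul_apply, ih, shiftOp_apply, derivative_C, sub_zero, ← C_mul,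
      ← mul_assoc, ← pow_succ']

theorem degree_shiftOp {z : ℂ} (hz : z ≠ 0) {p : ℂ[X]} (hp : p ≠ 0) :
    (shiftOp z p).degree = p.degree := by
  rw [shiftOp_apply, degree_sub_eq_left_of_degree_lt] <;> rw [degree_C_mul hz]
  exact degree_derivative_lt hp

/-- The parameter of the tensor density realising the module. -/
noncomputable def densityParam (z m₃ m₄ : ℂ) : ℂ := (m₄ - z * m₃) / z ^ 4

/-- The values on the `l k` of the character twisting the tensor density. -/
noncomputable def twist (z m₂ m₃ m₄ : ℂ) (k : ℕ) : ℂ :=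
  if k = 1 then (2 * densityParam z m₃ m₄ * z ^ 3 - m₃) / z ^ 2
  else if k = 2 then m₂ - densityParam z m₃ m₄ * z ^ 2 +
    (2 * densityParam z m₃ m₄ * z ^ 3 - m₃) / z
  else 0

/-- If i ≠ j then i + j ≥ 3, beyond the support of `twist`. Thus `twist` vanishes on [𝔫, 𝔫] and
defines a character. -/
theorem twist_mul_eq_zero (z m₂ m₃ m₄ : ℂ) (i j : ℕ+) :
    ((j : ℂ) - (i : ℂ)) * twist z m₂ m₃ m₄ (i + j) = 0 := by
  have hi := i.pos
  have hj := j.pos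
  by_cases h : (i : ℕ) = j
  · rw [h, sub_self, zero_mul]
  · rw [twist, if_neg (by omega), if_neg (by omega), mul_zero]

/-- The action of `l k` on `ℂ[s]`. -/
noncomputable def polyOp (z m₂ m₃ m₄ : ℂ) (k : ℕ) : Module.End ℂ ℂ[X] :=
  vectorField (shiftOp z) mulVar (densityParam z m₃ m₄) (X ^ (k + 1)) +
    algebraMap ℂ _ (twist z m₂ m₃ m₄ k)

theorem bracket_polyOp (z m₂ m₃ m₄ : ℂ) (i j : ℕ+) :
    ⁅polyOp z m₂ m₃ m₄ i, polyOp z m₂ m₃ m₄ j⁆ =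
      ((j : ℂ) - (i : ℂ)) • polyOp z m₂ m₃ m₄ (i + j : ℕ) := by
  have hc : ∀ (A B : Module.End ℂ ℂ[X]) (r s : ℂ),
      ⁅A + algebraMap ℂ _ r, B + algebraMap ℂ _ s⁆ = ⁅A, B⁆ := by
    intro A B r s
    simp only [LieRing.of_associative_ring_bracket, add_mul, mul_add, Algebra.commutes r B,
      Algebra.commutes s A, Algebra.commutes r (algebraMap ℂ (Module.End ℂ ℂ[X]) s)]
    abel
  have hp : (X ^ ((i : ℕ) + 1) * derivative (X ^ ((j : ℕ) + 1)) -
      derivative (X ^ ((i : ℕ) + 1)) * X ^ ((j : ℕ) + 1) : ℂ[X]) =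
      ((j : ℂ) - (i : ℂ)) • X ^ ((i : ℕ) + j + 1) := by
    rw [derivative_X_pow, derivative_X_pow, smul_eq_C_mul, Nat.add_sub_cancel, Nat.add_sub_cancel]
    simp only [map_sub, map_add, map_natCast, Nat.cast_add, Nat.cast_one]
    ring
  have ht : ((j : ℂ) - (i : ℂ)) • algebraMap ℂ (Module.End ℂ ℂ[X])
      (twist z m₂ m₃ m₄ ((i : ℕ) + j)) = 0 := by
    rw [Algebra.algebraMap_eq_smul_one, smul_smul, twist_mul_eq_zero, zero_smul]
  rw [polyOp, polyOp, polyOp, hc, bracket_vectorField (mulVar_mul_shiftOp z), smul_add, ht,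
    add_zero, hp, map_smul]

/-- The realisation of the induced module on `ℂ[s]`. -/
noncomputable def polyRep (z m₂ m₃ m₄ : ℂ) : positivePart →ₗ⁅ℂ⁆ Module.End ℂ ℂ[X] :=
  posHom (polyOp z m₂ m₃ m₄) (bracket_polyOp z m₂ m₃ m₄)

theorem polyRep_posL_one {z m₂ m₃ m₄ : ℂ} (hz : z ≠ 0) (k : ℕ) :
    polyRep z m₂ m₃ m₄ (posL k.succPNat) 1 - z ^ k • polyRep z m₂ m₃ m₄ (posL 1) 1 =
      scalar z m₂ m₃ m₄ (k + 1) • 1 := by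
  have hop : ∀ n : ℕ, polyOp z m₂ m₃ m₄ n 1 = X * C (z ^ (n + 1)) +
      C (densityParam z m₃ m₄ * (n + 1) * z ^ n + twist z m₂ m₃ m₄ n) := by
    intro n
    have h := fun m => shiftOp_pow_C z 1 m
    simp only [map_one, mul_one] at h
    simp only [polyOp, vectorField_apply, LinearMap.add_apply, Module.End.mul_apply,
      LinearMap.smul_apply, derivative_X_pow, map_mul, map_pow (aeval (shiftOp z)), aeval_X, h,
      aeval_C, Module.algebraMap_end_apply, smul_eq_C_mul, mulVar_apply, Nat.add_sub_cancel]
    simp only [map_pow, map_add, map_mul, Nat.cast_add, Nat.cast_one]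
    ring
  rw [polyRep, posHom_posL, posHom_posL, hop, hop, Nat.succPNat_coe, PNat.one_coe]
  -- Comparison of constant terms, where `k` stands for l_(k+1). The equations for l_2, l_3, l_4 are
  -- those that determine `twist` and `densityParam`; the case 0 is trivial because `scalar` is 0 at
  -- 1.
  have key : densityParam z m₃ m₄ * ((k.succ : ℕ) + 1) * z ^ k.succ + twist z m₂ m₃ m₄ k.succ -
      z ^ k * (densityParam z m₃ m₄ * ((1 : ℕ) + 1) * z ^ 1 + twist z m₂ m₃ m₄ 1) =
      scalar z m₂ m₃ m₄ (k + 1) := by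
    match k with
    | 0 => simp [scalar]
    | 1 =>
      simp [scalar, twist]
      field_simp
      ring
    | k + 2 =>
      rw [scalar_add_three]
      rcases k with _ | k
      · simp [twist]
        field_simp
        ring
      · simp [twist, densityParam]
        field_simp
        ring
  rw [← key, smul_eq_C_mul, smul_eq_C_mul]
  simp only [map_add, map_sub, map_mul, map_pow, pow_succ, map_one, Nat.succ_eq_add_one]
  ring

/-- The top term is s (z - d/ds)² p, whose leading coefficient is z² times that of p; the other
terms have degree at most that of p. -/
theorem degree_polyRep_posL_one {z m₂ m₃ m₄ : ℂ} (hz : z ≠ 0) {p : ℂ[X]} (hp : p ≠ 0) :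
    (polyRep z m₂ m₃ m₄ (posL 1) p).degree = p.degree + 1 := by
  have h1 := degree_shiftOp hz hp
  have h1' : shiftOp z p ≠ 0 := by rw [← degree_ne_bot, h1, degree_ne_bot]; exact hp
  have h2 := degree_shiftOp hz h1'
  have e : polyRep z m₂ m₃ m₄ (posL 1) p = X * shiftOp z (shiftOp z p) +
      (C (2 * densityParam z m₃ m₄) * shiftOp z p + C (twist z m₂ m₃ m₄ 1) * p) := by
    rw [polyRep, posHom_posL]
    simp [polyOp, vectorField_apply, mulVar_apply, smul_eq_C_mul, Module.algebraMap_end_apply,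
      pow_two, show (C 2 : ℂ[X]) = 2 from rfl]
    ring
  have hX : (X * shiftOp z (shiftOp z p)).degree = p.degree + 1 := by
    rw [degree_mul, degree_X, h2, h1, add_comm]
  have hlt : p.degree < p.degree + 1 := by
    rw [degree_eq_natDegree hp]
    exact_mod_cast Nat.lt_succ_self _
  rw [e, degree_add_eq_left_of_degree_lt, hX]
  rw [hX]
  refine lt_of_le_of_lt (degree_add_le _ _) (max_lt ?_ ?_) <;>
    refine lt_of_le_of_lt (smul_eq_C_mul (R := ℂ) _ ▸ degree_smul_le _ _) ?_
  · rwa [h1]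
  · exact hlt

/-- The factor X⁴ leaves only l_k with k ≥ 3, on which `twist` vanishes. -/
theorem exists_polyRep_eq (z m₂ m₃ m₄ : ℂ) (g : ℂ[X]) : ∃ y, polyRep z m₂ m₃ m₄ y =
    vectorField (shiftOp z) mulVar (densityParam z m₃ m₄) (X ^ 4 * g) := by
  induction g using Polynomial.induction_on' with
  | add p q hp hq =>
    obtain ⟨x, hx⟩ := hp
    obtain ⟨y, hy⟩ := hq
    exact ⟨x + y, by rw [map_add, hx, hy, mul_add, map_add]⟩
  | monomial n a =>
    refine ⟨a • posL (n + 2).succPNat, ?_⟩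
    rw [map_smul, polyRep, posHom_posL, polyOp, Nat.succPNat_coe, twist, if_neg (by omega),
      if_neg (by omega), map_zero, add_zero, ← map_smul, ← C_mul_X_pow_eq_monomial,
      smul_eq_C_mul]
    congr 1
    simp only [Nat.succ_eq_add_one]
    ring

/-- For nonzero density, every nonzero polynomial can be moved to a nonzero constant. -/
theorem exists_polyRep_eq_C {z m₂ m₃ m₄ : ℂ} (hz : z ≠ 0) (hb : densityParam z m₃ m₄ ≠ 0)
    {p : ℂ[X]} (hp : p ≠ 0) :
    ∃ (y : positivePart) (a : ℂ), a ≠ 0 ∧ polyRep z m₂ m₃ m₄ y p = C a := by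
  classical
  set E : Module.End ℂ ℂ[X] := aeval (shiftOp z) (X - C z) with hE
  have hEapp : ∀ q, E q = -derivative q := by
    intro q
    simp [hE, shiftOp]
  have hex : ∃ n, (E ^ n) p = 0 := by
    have : E = -(derivative : ℂ[X] →ₗ[ℂ] ℂ[X]) := LinearMap.ext hEapp
    refine ⟨p.natDegree + 1, ?_⟩
    rw [this, neg_pow (R := Module.End ℂ ℂ[X]), Module.End.mul_apply,
      Module.End.pow_apply (derivative : ℂ[X] →ₗ[ℂ] ℂ[X]),
      iterate_derivative_eq_zero (Nat.lt_succ_self _), map_zero]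
  -- n + 1 is the least power of -d/ds that kills p, so E^n p is a nonzero constant d.
  obtain ⟨n, hn⟩ : ∃ n, Nat.find hex = n + 1 := by
    refine Nat.exists_eq_succ_of_ne_zero fun h0 => hp ?_
    have := Nat.find_spec hex
    rw [h0] at this
    simpa using this
  have h1 : (E ^ (n + 1)) p = 0 := hn ▸ Nat.find_spec hex
  have h2 : (E ^ n) p ≠ 0 := Nat.find_min hex (by omega)
  obtain ⟨d, hd⟩ : ∃ d, (E ^ n) p = C d := by
    refine ⟨_, eq_C_of_natDegree_eq_zero (derivative_eq_zero.1 ?_)⟩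
    rw [pow_succ', Module.End.mul_apply, hEapp, neg_eq_zero] at h1
    exact h1
  have hd0 : d ≠ 0 := by rintro rfl; exact h2 (by rw [hd, map_zero])
  -- For f = X⁴ (X - z)^(n+1) the term S f(X) p vanishes. In b f'(X) p only b (n+1) X⁴ E^n p
  -- survives, and X⁴ multiplies the constant d by z⁴.
  obtain ⟨y, hy⟩ := exists_polyRep_eq z m₂ m₃ m₄ ((X - C z) ^ (n + 1))
  refine ⟨y, densityParam z m₃ m₄ * ((n + 1) * (z ^ 4 * d)), ?_, ?_⟩
  · have : ((n : ℂ) + 1) ≠ 0 := Nat.cast_add_one_ne_zero n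
    positivity
  · have hder : derivative (X ^ 4 * (X - C z) ^ (n + 1) : ℂ[X]) =
        4 * X ^ 3 * (X - C z) ^ (n + 1) + C ((n : ℂ) + 1) * (X ^ 4 * (X - C z) ^ n) := by
      simp [derivative_mul, derivative_pow, show (C 4 : ℂ[X]) = 4 from rfl]
      ring
    rw [hy, vectorField_apply, hder]
    rw [map_mul, map_add, map_mul, map_mul, map_mul, map_mul, map_pow, map_pow, map_pow,
      map_pow, ← hE, aeval_X, aeval_C]
    simp only [LinearMap.add_apply, Module.End.mul_apply, LinearMap.smul_apply, h1, map_zero,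
      zero_add, hd, shiftOp_pow_C, Module.algebraMap_end_apply, smul_eq_C_mul, C_mul]

end

end Virasoro

/-! ### The basis of the induced module. -/

namespace Virasoro

open LieInduction

theorem powGen_zero (z m₂ m₃ m₄ : ℂ) :
    powGen z m₂ m₃ m₄ 0 = indGen (character z m₂ m₃ m₄) := by
  rw [powGen, pow_zero, indGen]

theorem lie_posL_one_powGen (z m₂ m₃ m₄ : ℂ) (k : ℕ) :
    ⁅posL 1, powGen z m₂ m₃ m₄ k⁆ = powGen z m₂ m₃ m₄ (k + 1) := by
  rw [powGen, powGen, pow_succ', lie_eq_ι_smul, smul_tmul]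

/-- Moving l_k past one factor l_1 produces a multiple of l_(k+1) on a shorter power, so the
induction on `n` must treat all `k` at once. On the generator, l_k differs from a multiple of l_1 by
an element of 𝔞_z. -/
theorem lie_posL_powGen_mem (z m₂ m₃ m₄ : ℂ) (n : ℕ) (k : ℕ+) :
    ⁅posL k, powGen z m₂ m₃ m₄ n⁆ ∈ Submodule.span ℂ (Set.range (powGen z m₂ m₃ m₄)) := by
  set S := Submodule.span ℂ (Set.range (powGen z m₂ m₃ m₄)) with hS
  have hmem : ∀ n, powGen z m₂ m₃ m₄ n ∈ S := fun n => Submodule.subset_span ⟨n, rfl⟩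
  have hone : ∀ w ∈ S, ⁅posL 1, w⁆ ∈ S := by
    intro w hw
    induction hw using Submodule.span_induction with
    | mem w hw =>
      obtain ⟨n, rfl⟩ := hw
      rw [lie_posL_one_powGen]
      exact hmem _
    | zero => rw [lie_zero]; exact S.zero_mem
    | add x y _ _ hx hy => rw [lie_add]; exact S.add_mem hx hy
    | smul a x _ hx => rw [lie_smul]; exact S.smul_mem a hx
  induction n generalizing k with
  | zero =>
    by_cases hk : 2 ≤ k
    · have h := lie_indGen (character z m₂ m₃ m₄) (codimOneGen z k hk)
      have e : posL k = (codimOneGen z k hk : positivePart) + z ^ ((k : ℕ) - 1) • posL 1 :=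
        (sub_add_cancel _ _).symm
      rw [e, add_lie, smul_lie, powGen_zero, h, ← powGen_zero]
      exact S.add_mem (S.smul_mem _ (hmem 0)) (S.smul_mem _ (hone _ (hmem 0)))
    · obtain rfl : k = 1 := by
        have := k.pos
        have h2 : ¬ 2 ≤ (k : ℕ) := hk
        exact PNat.eq (by rw [PNat.one_coe]; omega)
      exact hone _ (hmem 0)
  | succ n ih =>
    rw [← lie_posL_one_powGen, leibniz_lie, bracket_posL, smul_lie, add_comm k 1]
    exact S.add_mem (S.smul_mem _ (ih _)) (hone _ (ih k))

theorem span_powGen (z m₂ m₃ m₄ : ℂ) :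
    Submodule.span ℂ (Set.range (powGen z m₂ m₃ m₄)) = ⊤ := by
  refine eq_top_of_indGen_mem (character z m₂ m₃ m₄) _
    (powGen_zero z m₂ m₃ m₄ ▸ Submodule.subset_span ⟨0, rfl⟩) fun x w hw => ?_
  have hx : x ∈ Submodule.span ℂ (Set.range posL) := by rw [span_posL]; trivial
  induction hx, hw using Submodule.span_induction₂ with
  | mem_mem x y hx hy =>
    obtain ⟨k, rfl⟩ := hx
    obtain ⟨n, rfl⟩ := hy
    exact lie_posL_powGen_mem z m₂ m₃ m₄ n k
  | zero_left y hy => simp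
  | zero_right x hx => simp
  | add_left x y z _ _ _ h₁ h₂ => rw [add_lie]; exact Submodule.add_mem _ h₁ h₂
  | add_right x y z _ _ _ h₁ h₂ => rw [lie_add]; exact Submodule.add_mem _ h₁ h₂
  | smul_left r x y _ _ h => rw [smul_lie]; exact Submodule.smul_mem _ _ h
  | smul_right r x y _ _ h => rw [lie_smul]; exact Submodule.smul_mem _ _ h

section

variable {z : ℂ} (hz : z ≠ 0) (m₂ m₃ m₄ : ℂ)

/-- The homomorphism from the induced module to its polynomial realisation. -/
noncomputable def toPoly : V z m₂ m₃ m₄ →ₗ[ℂ] Polynomial ℂ :=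
  indLift (character z m₂ m₃ m₄) (polyRep z m₂ m₃ m₄) 1
    (apply_eq_character_smul _ _ (polyRep_posL_one hz))

theorem toPoly_lie (x : positivePart) (w : V z m₂ m₃ m₄) :
    toPoly hz m₂ m₃ m₄ ⁅x, w⁆ = polyRep z m₂ m₃ m₄ x (toPoly hz m₂ m₃ m₄ w) :=
  indLift_lie _ _ _ _ _ _

theorem toPoly_powGen_zero : toPoly hz m₂ m₃ m₄ (powGen z m₂ m₃ m₄ 0) = 1 := by
  rw [powGen_zero]
  exact indLift_indGen _ _ _ _

theorem degree_toPoly_powGen (k : ℕ) :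
    (toPoly hz m₂ m₃ m₄ (powGen z m₂ m₃ m₄ k)).degree = k := by
  induction k with
  | zero => rw [toPoly_powGen_zero]; simp
  | succ k ih =>
    have h0 : toPoly hz m₂ m₃ m₄ (powGen z m₂ m₃ m₄ k) ≠ 0 := by
      rw [← Polynomial.degree_ne_bot, ih]
      exact WithBot.coe_ne_bot
    rw [← lie_posL_one_powGen, toPoly_lie, degree_polyRep_posL_one hz h0, ih]
    rfl

theorem linearIndependent_toPoly_powGen :
    LinearIndependent ℂ (toPoly hz m₂ m₃ m₄ ∘ powGen z m₂ m₃ m₄) :=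
  Polynomial.Sequence.linearIndependent
    ⟨toPoly hz m₂ m₃ m₄ ∘ powGen z m₂ m₃ m₄, degree_toPoly_powGen hz m₂ m₃ m₄⟩

/-- The basis `l 1 ^ k ⊗ 1` of the induced module. -/
noncomputable def powBasis : Module.Basis ℕ ℂ (V z m₂ m₃ m₄) :=
  Module.Basis.mk (LinearIndependent.of_comp _ (linearIndependent_toPoly_powGen hz m₂ m₃ m₄))
    (span_powGen z m₂ m₃ m₄).ge

theorem powBasis_apply (k : ℕ) : powBasis hz m₂ m₃ m₄ k = powGen z m₂ m₃ m₄ k :=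
  Module.Basis.mk_apply _ _ k

theorem toPoly_injective : Function.Injective (toPoly hz m₂ m₃ m₄) :=
  LinearMap.injective_of_linearIndependent (span_powGen z m₂ m₃ m₄)
    (linearIndependent_toPoly_powGen hz m₂ m₃ m₄)

end

/-! ### Simplicity and the one-dimensional quotient. -/

theorem isIrreducible_of_ne {z : ℂ} (hz : z ≠ 0) (m₂ m₃ m₄ : ℂ) (h : z * m₃ ≠ m₄) :
    LieModule.IsIrreducible ℂ positivePart (V z m₂ m₃ m₄) := by
  have hb : densityParam z m₃ m₄ ≠ 0 :=
    div_ne_zero (sub_ne_zero.2 h.symm) (pow_ne_zero _ hz)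
  have : Nontrivial (V z m₂ m₃ m₄) :=
    ⟨powBasis hz m₂ m₃ m₄ 0, 0, (powBasis hz m₂ m₃ m₄).ne_zero 0⟩
  refine LieModule.IsIrreducible.mk fun N hN => ?_
  obtain ⟨v, hv, hv0⟩ := N.toSubmodule.ne_bot_iff.1 (mt (LieSubmodule.toSubmodule_eq_bot N).1 hN)
  obtain ⟨y, a, ha, hy⟩ := exists_polyRep_eq_C (m₂ := m₂) hz hb
    ((map_ne_zero_iff _ (toPoly_injective hz m₂ m₃ m₄)).2 hv0)
  have e : ⁅y, v⁆ = a • powGen z m₂ m₃ m₄ 0 := by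
    apply toPoly_injective hz m₂ m₃ m₄
    rw [toPoly_lie, hy, map_smul, toPoly_powGen_zero, Polynomial.smul_eq_C_mul, mul_one]
  have hmem : powGen z m₂ m₃ m₄ 0 ∈ N := by
    have h1 := N.smul_mem a⁻¹ (e ▸ N.lie_mem hv : a • powGen z m₂ m₃ m₄ 0 ∈ N)
    rwa [inv_smul_smul₀ ha] at h1
  rw [← LieSubmodule.toSubmodule_eq_top]
  exact eq_top_of_indGen_mem _ _ (powGen_zero z m₂ m₃ m₄ ▸ hmem) fun x w hw => N.lie_mem hw

/-- The character of the positive part with values the twisting scalars. -/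
noncomputable def twistCharacter (z m₂ m₃ m₄ : ℂ) : LieAlgebra.LieCharacter ℂ positivePart :=
  posHom (twist z m₂ m₃ m₄) fun i j => by
    rw [smul_eq_mul, twist_mul_eq_zero, LieRing.of_associative_ring_bracket, mul_comm, sub_self]

theorem twistCharacter_posL (z m₂ m₃ m₄ : ℂ) (k : ℕ+) :
    twistCharacter z m₂ m₃ m₄ (posL k) = twist z m₂ m₃ m₄ k :=
  posHom_posL _ _ k

/-- With b = 0 the constants matched in `polyRep_posL_one` come from `twist` alone, so
`twistCharacter` extends the character of 𝔞_z and Frobenius reciprocity applies. -/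
theorem exists_surjective_twistCharacter {z : ℂ} (hz : z ≠ 0) (m₂ m₃ m₄ : ℂ)
    (h : z * m₃ = m₄) :
    ∃ f : V z m₂ m₃ m₄ →ₗ⁅ℂ, positivePart⁆ CharModule (twistCharacter z m₂ m₃ m₄),
      Function.Surjective f := by
  have hb : densityParam z m₃ m₄ = 0 := by rw [densityParam, h, sub_self, zero_div]
  set χ := twistCharacter z m₂ m₃ m₄
  have hv := apply_eq_character_smul (z := z) (m₂ := m₂) (m₃ := m₃) (m₄ := m₄)
    (LieModule.toEnd ℂ positivePart (CharModule χ)) (CharModule.gen χ) (by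
      intro k
      rw [LieModule.toEnd_apply_apply, LieModule.toEnd_apply_apply, CharModule.lie_def,
        CharModule.lie_def, twistCharacter_posL, twistCharacter_posL, smul_smul, ← sub_smul]
      congr 1
      rw [Nat.succPNat_coe, PNat.one_coe]
      match k with
      | 0 => simp [scalar]
      | 1 =>
        simp [scalar, twist, hb]
        field_simp
        ring
      | k + 2 =>
        have hb' := h ▸ hb
        rw [scalar_add_three, ← h]
        rcases k with _ | k
        · simp [twist, hb']
          field_simp
        · simp [twist, hb']
          field_simp
          ring)
  refine ⟨{ indLift _ _ (CharModule.gen χ) hv with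
    map_lie' := fun {x w} => indLift_lie _ _ _ hv x w }, fun c => ?_⟩
  refine ⟨(show ℂ from c) • indGen _, ?_⟩
  refine (map_smul (indLift _ _ (CharModule.gen χ) hv) _ _).trans ?_
  rw [indLift_indGen]
  exact mul_one (show ℂ from c)

theorem finrank_charModule {R L : Type*} [CommRing R] [StrongRankCondition R] [LieRing L]
    [LieAlgebra R L] (χ : LieAlgebra.LieCharacter R L) : Module.finrank R (CharModule χ) = 1 :=
  Module.finrank_self R

theorem not_isIrreducible_of_eq {z : ℂ} (hz : z ≠ 0) (m₂ m₃ m₄ : ℂ) (h : z * m₃ = m₄) :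
    ¬ LieModule.IsIrreducible ℂ positivePart (V z m₂ m₃ m₄) := by
  intro hirr
  obtain ⟨f, hf⟩ := exists_surjective_twistCharacter hz m₂ m₃ m₄ h
  have hfin : Module.finrank ℂ (CharModule (twistCharacter z m₂ m₃ m₄)) = 1 :=
    finrank_charModule _
  rcases hirr.eq_bot_or_eq_top f.ker with hk | hk
  · have hinj : Function.Injective f := (LieModuleHom.ker_eq_bot f).1 hk
    have e := (LinearEquiv.ofBijective f.toLinearMap ⟨hinj, hf⟩).finrank_eq
    -- The basis is infinite, so `Nat.card ℕ` takes its default value 0, which contradicts dimension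
    -- 1.
    rw [hfin, Module.finrank_eq_nat_card_basis (powBasis hz m₂ m₃ m₄)] at e
    simp at e
  · obtain ⟨w, hw⟩ := hf (CharModule.gen _)
    have : w ∈ f.ker := hk ▸ LieSubmodule.mem_top w
    rw [LieModuleHom.mem_ker, hw] at this
    exact one_ne_zero (α := ℂ) this

end Virasoro

theorem proposition3 (z m₂ m₃ m₄ : ℂ) (hz : z ≠ 0) :
    (∃ b : Module.Basis ℕ ℂ (Virasoro.V z m₂ m₃ m₄),
      ∀ k : ℕ, b k = Virasoro.powGen z m₂ m₃ m₄ k) ∧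
    (LieModule.IsIrreducible ℂ Virasoro.positivePart (Virasoro.V z m₂ m₃ m₄) ↔ z * m₃ ≠ m₄) ∧
    (z * m₃ = m₄ →
      ∃ χ : LieAlgebra.LieCharacter ℂ Virasoro.positivePart,
        χ (Virasoro.posL 1) = -(m₃ / z ^ 2) ∧
        χ (Virasoro.posL 2) = m₂ - m₃ / z ∧
        (∀ k : ℕ+, 3 ≤ k → χ (Virasoro.posL k) = 0) ∧
        Module.finrank ℂ (CharModule χ) = 1 ∧
        ∃ f : Virasoro.V z m₂ m₃ m₄ →ₗ⁅ℂ, Virasoro.positivePart⁆ CharModule χ,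
          Function.Surjective f) := by
  refine ⟨⟨Virasoro.powBasis hz m₂ m₃ m₄, Virasoro.powBasis_apply hz m₂ m₃ m₄⟩,
    ⟨fun hirr h => Virasoro.not_isIrreducible_of_eq hz m₂ m₃ m₄ h hirr,
      Virasoro.isIrreducible_of_ne hz m₂ m₃ m₄⟩, fun h => ?_⟩
  have hb : Virasoro.densityParam z m₃ m₄ = 0 := by
    rw [Virasoro.densityParam, h, sub_self, zero_div]
  refine ⟨Virasoro.twistCharacter z m₂ m₃ m₄, ?_, ?_, fun k hk => ?_,
    Virasoro.finrank_charModule _, Virasoro.exists_surjective_twistCharacter hz m₂ m₃ m₄ h⟩ <;>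
    rw [Virasoro.twistCharacter_posL, Virasoro.twist]
  · simp [hb, neg_div]
  · simp [hb, neg_div, sub_eq_add_neg]
  · have hk' : 3 ≤ (k : ℕ) := hk
    rw [if_neg (by omega), if_neg (by omega)]
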